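/- There is an absolute constant $N$ such that for every integer $n \ge N$ the following holds. Let $K \subset \mathbb{R}^n$ be a convex body (a compact convex set) with the origin in its interior, and let $\lambda_1, \dots, \lambda_m$ be real numbers with $\lambda_i \in (e^{-n}, 1)$ for every $i$ and $$\sum_{i=1}^m \lambda_i^n \;\ge\; (n\log n + n\log\log n + 4n)\,\frac{\mathrm{Vol}_n(K-K)}{\mathrm{Vol}_n(K)},$$ where $\log$ is the natural logarithm, $\mathrm{Vol}_n$ is Lebesgue measure in $\mathbb{R}^n$ and $K - \mu K = \{x - \mu y : x, y \in K\}$ for $\mu \in \mathbb{R}$. Let $X_1, \dots, X_m$ be jointly independent random vectors in $\mathbb{R}^n$ such that, for each $i$, $X_i$ is uniformly distributed in $K - \lambda_i K$. Then the event $K \subseteq \bigcup_{i=1}^m (X_i + \lambda_i K)$ has probability at least $1 - e^{-0.3 n}$. -/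

import Mathlib

open MeasureTheory ProbabilityTheory
open scoped Pointwise

theorem isCompact_volume_add_le {A B C : Set ℝ} (hA : IsCompact A) (hB : IsCompact B)
    (hA' : A.Nonempty) (hB' : B.Nonempty) (hC : ∀ x ∈ A, ∀ y ∈ B, x + y ∈ C) :
    volume A + volume B ≤ volume C := by
  have ha := hA.sSup_mem hA'
  have hb := hB.sInf_mem hB'
  set a := sSup A
  set b := sInf B
  have h1 : volume ((fun x => b + x) '' A) = volume A := by
    simp
  have h2 : volume ((fun x => a + x) '' B) = volume B := by
    simp
  rw [← h1, ← h2, ← measure_union₀]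
  · refine measure_mono (Set.union_subset ?_ ?_)
    · rintro _ ⟨x, hx, rfl⟩
      simpa only [add_comm x b] using hC x hx b hb
    · rintro _ ⟨x, hx, rfl⟩
      exact hC a ha x hx
  · exact (hB.image (by fun_prop)).measurableSet.nullMeasurableSet
  · refine measure_mono_null (t := {a + b}) ?_ (by simp)
    rintro z ⟨⟨x, hx, rfl⟩, ⟨y, hy, hxy⟩⟩
    have h3 : x ≤ a := le_csSup hA.bddAbove hx
    have h4 : b ≤ y := csInf_le hB.bddBelow hy
    simp only [Set.mem_singleton_iff] at hxy ⊢
    linarith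

theorem volume_add_le_of_add_mem {A B C : Set ℝ} (hA : MeasurableSet A) (hB : MeasurableSet B)
    (hA' : A.Nonempty) (hB' : B.Nonempty) (hC : ∀ x ∈ A, ∀ y ∈ B, x + y ∈ C) :
    volume A + volume B ≤ volume C := by
  obtain ⟨a, ha⟩ := hA'
  obtain ⟨b, hb⟩ := hB'
  rw [hA.measure_eq_iSup_isCompact, hB.measure_eq_iSup_isCompact]
  simp only [iSup_and']
  refine ENNReal.biSup_add_biSup_le (s := {s | s ⊆ A ∧ IsCompact s})
    (t := {s | s ⊆ B ∧ IsCompact s}) ⟨∅, Set.empty_subset _, isCompact_empty⟩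
    ⟨∅, Set.empty_subset _, isCompact_empty⟩ ?_
  rintro s ⟨hs, hsc⟩ t ⟨ht, htc⟩
  calc volume s + volume t ≤ volume (insert a s) + volume (insert b t) := by
        gcongr <;> exact Set.subset_insert _ _
    _ ≤ volume C := by
        refine isCompact_volume_add_le (hsc.insert a) (htc.insert b) ⟨a, by simp⟩ ⟨b, by simp⟩ ?_
        intro x hx y hy
        exact hC x (Set.insert_subset ha hs hx) y (Set.insert_subset hb ht hy)

theorem lintegral_eq_lintegral_Ioo_meas_lt {α : Type*} [MeasurableSpace α] {μ : Measure α}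
    {f : α → ENNReal} (hf : Measurable f) (h1 : ∀ x, f x ≤ 1) :
    ∫⁻ x, f x ∂μ = ∫⁻ t in Set.Ioo (0 : ℝ) 1, μ {x | ENNReal.ofReal t < f x} := by
  have hfin : ∀ x, f x ≠ ⊤ := fun x => ((h1 x).trans_lt ENNReal.one_lt_top).ne
  have h2 := lintegral_eq_lintegral_meas_lt μ (f := fun x => (f x).toReal)
    (Filter.Eventually.of_forall fun x => ENNReal.toReal_nonneg) hf.ennreal_toReal.aemeasurable
  simp only [ENNReal.ofReal_toReal (hfin _)] at h2
  rw [h2]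
  have h3 : ∀ t ∈ Set.Ioi (0 : ℝ), μ {a | t < (f a).toReal} = μ {x | ENNReal.ofReal t < f x} := by
    intro t ht
    congr 1
    ext x
    exact (ENNReal.ofReal_lt_iff_lt_toReal (le_of_lt ht) (hfin x)).symm
  rw [setLIntegral_congr_fun measurableSet_Ioi h3, ← Set.Ioo_union_Ici_eq_Ioi zero_lt_one,
    lintegral_union measurableSet_Ici]
  · rw [setLIntegral_congr_fun (g := fun _ => 0) measurableSet_Ici]
    · simp
    · intro t ht
      have : {x | ENNReal.ofReal t < f x} = ∅ := by
        ext x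
        simp only [Set.mem_ofPred_eq, Set.mem_empty_iff_false, iff_false, not_lt]
        exact (h1 x).trans (by simpa using ht)
      simp [this]
  · rw [Set.disjoint_left]
    rintro x ⟨_, hx⟩ hx'
    exact absurd hx' (not_le.2 hx)

theorem lintegral_add_lintegral_le_of_min_le {f g h : ℝ → ENNReal} (hf : Measurable f)
    (hg : Measurable g) (hh : Measurable h) (hf1 : ⨆ x, f x = 1) (hg1 : ⨆ x, g x = 1)
    (hfgh : ∀ x y, min (f x) (g y) ≤ h (x + y)) :
    (∫⁻ x, f x) + ∫⁻ x, g x ≤ ∫⁻ x, h x := by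
  have hf' : ∀ x, f x ≤ 1 := fun x => hf1 ▸ le_iSup f x
  have hg' : ∀ x, g x ≤ 1 := fun x => hg1 ▸ le_iSup g x
  calc (∫⁻ x, f x) + ∫⁻ x, g x
      = ∫⁻ t in Set.Ioo (0 : ℝ) 1, (volume {x | ENNReal.ofReal t < f x}
          + volume {x | ENNReal.ofReal t < g x}) := by
        rw [lintegral_eq_lintegral_Ioo_meas_lt hf hf', lintegral_eq_lintegral_Ioo_meas_lt hg hg',
          lintegral_add_left]
        exact Antitone.measurable fun s t hst =>
          measure_mono fun x hx => (ENNReal.ofReal_le_ofReal hst).trans_lt hx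
    _ ≤ ∫⁻ t in Set.Ioo (0 : ℝ) 1, volume {x | ENNReal.ofReal t < min (h x) 1} := by
        refine setLIntegral_mono' measurableSet_Ioo fun t ht => ?_
        have ht1 : ENNReal.ofReal t < 1 := by simpa using ht.2
        obtain ⟨x, hx⟩ := lt_iSup_iff.1 (hf1.symm ▸ ht1)
        obtain ⟨y, hy⟩ := lt_iSup_iff.1 (hg1.symm ▸ ht1)
        refine volume_add_le_of_add_mem (measurableSet_lt measurable_const hf)
          (measurableSet_lt measurable_const hg) ⟨x, hx⟩ ⟨y, hy⟩ ?_
        intro x hx y hy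
        exact lt_min ((lt_min hx hy).trans_le (hfgh x y)) ht1
    _ = ∫⁻ x, min (h x) 1 :=
        (lintegral_eq_lintegral_Ioo_meas_lt (hh.min measurable_const) fun x => min_le_right _ _).symm
    _ ≤ ∫⁻ x, h x := lintegral_mono fun x => min_le_left _ _

theorem ENNReal.four_mul_le_add_sq (a b : ENNReal) : 4 * (a * b) ≤ (a + b) ^ 2 := by
  induction a with
  | top => simp
  | coe a =>
  induction b with
  | top => simp
  | coe b =>
  norm_cast
  have := four_mul_le_sq_add a b
  rwa [mul_assoc] at this

theorem prekopaLeindler_real_of_iSup_ne_top {f g h : ℝ → ENNReal} (hf : Measurable f)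
    (hg : Measurable g) (hh : Measurable h) (hf1 : ⨆ x, f x ≠ ⊤) (hg1 : ⨆ x, g x ≠ ⊤)
    (hfgh : ∀ x y, f x * g y ≤ h (x + y) ^ 2) :
    4 * ((∫⁻ x, f x) * ∫⁻ x, g x) ≤ (∫⁻ x, h x) ^ 2 := by
  by_cases hf0 : ⨆ x, f x = 0
  · have : ∀ x, f x = 0 := by simpa using hf0
    simp [this]
  by_cases hg0 : ⨆ x, g x = 0
  · have : ∀ x, g x = 0 := by simpa using hg0
    simp [this]
  set a := ⨆ x, f x
  set b := ⨆ x, g x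
  obtain ⟨c, hc⟩ : ∃ c : ENNReal, c ^ 2 = a * b := by
    refine ⟨(a * b) ^ (1 / 2 : ℝ), ?_⟩
    rw [← ENNReal.rpow_natCast, ← ENNReal.rpow_mul]
    simp
  have hab : a * b ≠ ⊤ := ENNReal.mul_ne_top hf1 hg1
  have hab0 : a * b ≠ 0 := mul_ne_zero hf0 hg0
  have hc0 : c ≠ 0 := by
    rintro rfl
    exact hab0 (by simp [← hc])
  have hct : c ≠ ⊤ := by
    rintro rfl
    exact hab (by simp [← hc])
  have key := lintegral_add_lintegral_le_of_min_le (f := fun x => a⁻¹ * f x)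
    (g := fun x => b⁻¹ * g x) (h := fun x => c⁻¹ * h x) (hf.const_mul _) (hg.const_mul _)
    (hh.const_mul _) (by rw [← ENNReal.mul_iSup, ENNReal.inv_mul_cancel hf0 hf1])
    (by rw [← ENNReal.mul_iSup, ENNReal.inv_mul_cancel hg0 hg1]) (by
      intro x y
      rw [← ENNReal.pow_le_pow_left_iff two_ne_zero]
      calc (min (a⁻¹ * f x) (b⁻¹ * g y)) ^ 2 ≤ (a⁻¹ * f x) * (b⁻¹ * g y) := by
            rw [sq]
            exact mul_le_mul' (min_le_left _ _) (min_le_right _ _)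
        _ = (c⁻¹) ^ 2 * (f x * g y) := by
            rw [← ENNReal.inv_pow, hc, ENNReal.mul_inv (Or.inl hf0) (Or.inl hf1)]
            ring
        _ ≤ (c⁻¹ * h (x + y)) ^ 2 := by
            rw [mul_pow]
            gcongr
            exact hfgh x y)
  rw [lintegral_const_mul _ hf, lintegral_const_mul _ hg, lintegral_const_mul _ hh] at key
  have key2 := (ENNReal.four_mul_le_add_sq _ _).trans (pow_le_pow_left' key 2)
  rw [mul_pow, ← ENNReal.inv_pow, hc] at key2
  calc 4 * ((∫⁻ x, f x) * ∫⁻ x, g x)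
      = (a * b) * (4 * (a⁻¹ * (∫⁻ x, f x) * (b⁻¹ * ∫⁻ x, g x))) := by
        calc 4 * ((∫⁻ x, f x) * ∫⁻ x, g x)
          _ = (a * a⁻¹) * (b * b⁻¹) * (4 * ((∫⁻ x, f x) * ∫⁻ x, g x)) := by
              rw [ENNReal.mul_inv_cancel hf0 hf1, ENNReal.mul_inv_cancel hg0 hg1]; simp
          _ = _ := by ring
    _ ≤ (a * b) * ((a * b)⁻¹ * (∫⁻ x, h x) ^ 2) := by gcongr
    _ = (∫⁻ x, h x) ^ 2 := by
        rw [← mul_assoc, ENNReal.mul_inv_cancel hab0 hab, one_mul]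

theorem ENNReal.iSup_min_natCast (a : ENNReal) : ⨆ k : ℕ, min a k = a := by
  rw [← inf_iSup_eq, ENNReal.iSup_natCast, inf_top_eq]

theorem prekopaLeindler_real {f g h : ℝ → ENNReal} (hf : Measurable f)
    (hg : Measurable g) (hh : Measurable h) (hfgh : ∀ x y, f x * g y ≤ h (x + y) ^ 2) :
    4 * ((∫⁻ x, f x) * ∫⁻ x, g x) ≤ (∫⁻ x, h x) ^ 2 := by
  have trunc : ∀ u : ℝ → ENNReal, Measurable u →
      ∫⁻ x, u x = ⨆ k : ℕ, ∫⁻ x, min (u x) k := by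
    intro u hu
    rw [← lintegral_iSup (fun k => hu.min measurable_const)
      (fun i j hij x => min_le_min_left _ (by exact_mod_cast hij))]
    simp only [ENNReal.iSup_min_natCast]
  have bdd : ∀ (u : ℝ → ENNReal) (k : ℕ), ⨆ x, min (u x) k ≠ ⊤ := fun u k =>
    ((iSup_le fun x => min_le_right _ _).trans_lt (ENNReal.natCast_lt_top k)).ne
  rw [trunc f hf, trunc g hg, ENNReal.iSup_mul, ENNReal.mul_iSup]
  refine iSup_le fun k => ?_
  rw [ENNReal.mul_iSup, ENNReal.mul_iSup]
  refine iSup_le fun l => ?_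
  refine prekopaLeindler_real_of_iSup_ne_top (hf.min measurable_const) (hg.min measurable_const)
    hh (bdd f k) (bdd g l) fun x y => ?_
  exact (mul_le_mul' (min_le_left _ _) (min_le_left _ _)).trans (hfgh x y)

theorem prekopaLeindler_pi (n : ℕ) {f g h : (Fin n → ℝ) → ENNReal} (hf : Measurable f)
    (hg : Measurable g) (hh : Measurable h) (hfgh : ∀ x y, f x * g y ≤ h (x + y) ^ 2) :
    4 ^ n * ((∫⁻ x, f x) * ∫⁻ x, g x) ≤ (∫⁻ x, h x) ^ 2 := by
  induction n with
  | zero =>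
    have : ∀ u : (Fin 0 → ℝ) → ENNReal, ∫⁻ x, u x = u 0 := by
      intro u
      rw [lintegral_unique]
      simp only [volume_pi, Measure.pi_univ, Finset.univ_eq_empty, Finset.prod_empty, mul_one]
      exact congrArg u (Subsingleton.elim _ _)
    simp only [this]
    simpa using hfgh 0 0
  | succ n ih =>
    let e := (MeasurableEquiv.piFinSuccAbove (fun _ : Fin (n + 1) => ℝ) 0).symm
    have he : MeasurePreserving e :=
      (volume_preserving_piFinSuccAbove (fun _ : Fin (n + 1) => ℝ) 0).symm
    have hadd : ∀ s t x y, e (s, x) + e (t, y) = e (s + t, x + y) := by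
      intro s t x y
      ext i
      refine Fin.cases ?_ (fun i => ?_) i <;> simp [e]
    have fub : ∀ u : (Fin (n + 1) → ℝ) → ENNReal, Measurable u →
        ∫⁻ x, u x = ∫⁻ s, ∫⁻ x, u (e (s, x)) := by
      intro u hu
      rw [← he.lintegral_comp hu, Measure.volume_eq_prod,
        lintegral_prod (fun z => u (e z)) (hu.comp e.measurable).aemeasurable]
    have meas : ∀ u : (Fin (n + 1) → ℝ) → ENNReal, Measurable u →
        Measurable fun s => ∫⁻ x, u (e (s, x)) := fun u hu =>
      (hu.comp e.measurable).lintegral_prod_right'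
    rw [fub f hf, fub g hg, fub h hh]
    have key := prekopaLeindler_real (f := fun s => 2 ^ n * ∫⁻ x, f (e (s, x)))
      (g := fun s => 2 ^ n * ∫⁻ x, g (e (s, x))) ((meas f hf).const_mul _)
      ((meas g hg).const_mul _) (meas h hh) (by
        intro s t
        have := ih (f := fun x => f (e (s, x))) (g := fun x => g (e (t, x)))
          (h := fun x => h (e (s + t, x))) (by fun_prop) (by fun_prop) (by fun_prop)
          (fun x y => by rw [← hadd]; exact hfgh _ _)
        refine le_trans (le_of_eq ?_) this
        have : (4 : ENNReal) ^ n = 2 ^ n * 2 ^ n := by rw [← mul_pow]; norm_num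
        rw [this]
        ring)
    rw [lintegral_const_mul _ (meas f hf), lintegral_const_mul _ (meas g hg)] at key
    refine le_trans (le_of_eq ?_) key
    have : (4 : ENNReal) ^ (n + 1) = 4 * (2 ^ n * 2 ^ n) := by
      rw [← mul_pow, pow_succ']; norm_num
    rw [this]
    ring

theorem four_pow_mul_volume_mul_volume_le {n : ℕ} {A B C : Set (EuclideanSpace ℝ (Fin n))}
    (hA : MeasurableSet A) (hB : MeasurableSet B) (hC : MeasurableSet C) (h : A + B ⊆ C) :
    4 ^ n * (volume A * volume B) ≤ volume C ^ 2 := by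
  have hm : Measurable (WithLp.toLp 2 : (Fin n → ℝ) → EuclideanSpace ℝ (Fin n)) :=
    (PiLp.volume_preserving_toLp (Fin n)).measurable
  have hv : ∀ S : Set (EuclideanSpace ℝ (Fin n)), MeasurableSet S →
      volume S = ∫⁻ x : Fin n → ℝ, S.indicator 1 (WithLp.toLp 2 x) := by
    intro S hS
    rw [(PiLp.volume_preserving_toLp (Fin n)).lintegral_comp (measurable_one.indicator hS),
      lintegral_indicator_one hS]
  rw [hv A hA, hv B hB, hv C hC]
  refine prekopaLeindler_pi n ((measurable_one.indicator hA).comp hm)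
    ((measurable_one.indicator hB).comp hm) ((measurable_one.indicator hC).comp hm) fun x y => ?_
  by_cases hx : WithLp.toLp 2 x ∈ A
  · by_cases hy : WithLp.toLp 2 y ∈ B
    · have : WithLp.toLp 2 x + WithLp.toLp 2 y ∈ C := h (Set.add_mem_add hx hy)
      simp [hx, hy, this]
    · simp [hy]
  · simp [hx]

theorem IsCompact.sub {G : Type*} [TopologicalSpace G] [AddGroup G] [IsTopologicalAddGroup G]
    {A B : Set G} (hA : IsCompact A) (hB : IsCompact B) : IsCompact (A - B) := by
  rw [sub_eq_add_neg]
  exact hA.add hB.neg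

theorem isOpen_setOf_not_subset_iUnion_vadd {G ι : Type*} [TopologicalSpace G] [AddCommGroup G]
    [IsTopologicalAddGroup G] [Finite ι] {K : Set G} {L : ι → Set G}
    (hL : ∀ i, IsClosed (L i)) : IsOpen {x : ι → G | ¬ K ⊆ ⋃ i, x i +ᵥ L i} := by
  have : {x : ι → G | ¬ K ⊆ ⋃ i, x i +ᵥ L i} =
      ⋃ y ∈ K, ⋂ i, (fun x : ι → G => y - x i) ⁻¹' (L i)ᶜ := by
    ext x
    simp [Set.not_subset, Set.mem_vadd_set_iff_neg_vadd_mem, neg_add_eq_sub]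
  rw [this]
  exact isOpen_biUnion fun y _ => isOpen_iInter_of_finite fun i =>
    (hL i).isOpen_compl.preimage (by fun_prop)

section Haar

variable {E : Type*} [NormedAddCommGroup E] [NormedSpace ℝ E] [FiniteDimensional ℝ E]
  [MeasurableSpace E] [BorelSpace E] {μ : Measure E} [μ.IsAddHaarMeasure]

theorem lintegral_measure_inter_vadd {K : Set E} (hK : MeasurableSet K) :
    ∫⁻ x, μ (K ∩ (x +ᵥ K)) ∂μ = μ K * μ K := by
  have hm : Measurable fun p : E × E => K.indicator (1 : E → ENNReal) p.2 *
      K.indicator (1 : E → ENNReal) (p.2 - p.1) :=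
    ((measurable_one.indicator hK).comp measurable_snd).mul
      ((measurable_one.indicator hK).comp (measurable_snd.sub measurable_fst))
  calc ∫⁻ x, μ (K ∩ (x +ᵥ K)) ∂μ
      = ∫⁻ x, ∫⁻ y, K.indicator 1 y * K.indicator 1 (y - x) ∂μ ∂μ := by
        refine lintegral_congr fun x => ?_
        rw [← lintegral_indicator_one (hK.inter (hK.const_vadd x))]
        refine lintegral_congr fun y => ?_
        have : y ∈ x +ᵥ K ↔ y - x ∈ K := by
          rw [Set.mem_vadd_set_iff_neg_vadd_mem, vadd_eq_add, neg_add_eq_sub]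
        by_cases h1 : y ∈ K <;> by_cases h2 : y - x ∈ K <;> simp [h1, h2, this]
    _ = ∫⁻ y, ∫⁻ x, K.indicator 1 y * K.indicator 1 (y - x) ∂μ ∂μ :=
        lintegral_lintegral_swap hm.aemeasurable
    _ = ∫⁻ y, K.indicator 1 y * μ K ∂μ := by
        refine lintegral_congr fun y => ?_
        rw [lintegral_const_mul _ (by
          exact (measurable_one.indicator hK).comp (measurable_const.sub measurable_id)),
          lintegral_sub_left_eq_self, lintegral_indicator_one hK]
    _ = μ K * μ K := by
        rw [lintegral_mul_const _ (measurable_one.indicator hK), lintegral_indicator_one hK]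

theorem Convex.measure_sub_self_le {K : Set E} (hK : IsCompact K) (hc : Convex ℝ K)
    (h0 : μ K ≠ 0) : μ (K - K) ≤ 4 ^ Module.finrank ℝ E * μ K := by
  set d := Module.finrank ℝ E
  have hhalf : ∀ S : Set E, μ ((1 / 2 : ℝ) • S) = (2 ^ d)⁻¹ * μ S := by
    intro S
    rw [Measure.addHaar_smul_of_nonneg _ (by norm_num), ENNReal.ofReal_pow (by norm_num),
      one_div, ENNReal.ofReal_inv_of_pos two_pos, ENNReal.ofReal_ofNat, ENNReal.inv_pow]
  have hsub : ∀ x ∈ (1 / 2 : ℝ) • (K - K), (2 ^ d)⁻¹ * μ K ≤ μ (K ∩ (x +ᵥ K)) := by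
    rintro _ ⟨_, ⟨a, ha, b, hb, rfl⟩, rfl⟩
    rw [← hhalf, ← measure_vadd μ ((1 / 2 : ℝ) • a)]
    refine measure_mono ?_
    rintro _ ⟨_, ⟨k, hk, rfl⟩, rfl⟩
    refine ⟨hc ha hk (by norm_num) (by norm_num) (by norm_num), (1 / 2 : ℝ) • b + (1 / 2 : ℝ) • k,
      hc hb hk (by norm_num) (by norm_num) (by norm_num), ?_⟩
    simp only [vadd_eq_add, smul_sub]
    abel
  have h1 : (2 ^ d)⁻¹ * μ K * ((2 ^ d)⁻¹ * μ (K - K)) ≤ μ K * μ K := by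
    rw [← hhalf (K - K), ← lintegral_measure_inter_vadd hK.measurableSet, ← setLIntegral_const]
    exact (setLIntegral_mono' ((hK.sub hK).smul _).measurableSet hsub).trans
      (setLIntegral_le_lintegral _ _)
  have hK' : μ K ≠ ⊤ := hK.measure_ne_top
  have h2 : ((2 : ENNReal) ^ d) * (2 ^ d)⁻¹ = 1 :=
    ENNReal.mul_inv_cancel (by simp) (by simp)
  calc μ (K - K) = (2 ^ d * 2 ^ d * (μ K)⁻¹) * ((2 ^ d)⁻¹ * μ K * ((2 ^ d)⁻¹ * μ (K - K))) := by
        calc μ (K - K) = (2 ^ d * (2 ^ d)⁻¹) * (2 ^ d * (2 ^ d)⁻¹) * (μ K * (μ K)⁻¹)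
              * μ (K - K) := by
              rw [h2, ENNReal.mul_inv_cancel h0 hK']; simp
          _ = _ := by ring
    _ ≤ (2 ^ d * 2 ^ d * (μ K)⁻¹) * (μ K * μ K) := by gcongr
    _ = 4 ^ d * μ K * (μ K * (μ K)⁻¹) := by
        rw [← mul_pow]
        norm_num
        ring
    _ = 4 ^ d * μ K := by rw [ENNReal.mul_inv_cancel h0 hK', mul_one]

variable {Ω : Type*} [MeasurableSpace Ω] {P : Measure Ω} [IsProbabilityMeasure P]

theorem ProbabilityTheory.pdf.IsUniform.measure_sub_notMem {K : Set E} (hK : IsCompact K)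
    (hc : Convex ℝ K) (h0 : μ K ≠ 0) {l ε : ℝ} (hε : 0 ≤ ε) (hl : ε ≤ l) {X : Ω → E}
    (hX : Measurable X) (hu : pdf.IsUniform X (K - l • K) P μ) {y : E} (hy : y ∈ K - ε • K) :
    P {ω | y - X ω ∉ (l - ε) • K} =
      ENNReal.ofReal (1 - (l - ε) ^ Module.finrank ℝ E * (μ.real K / μ.real (K - l • K))) := by
  have hKl : IsCompact (K - l • K) := hK.sub (hK.smul l)
  have hne : K.Nonempty := nonempty_of_measure_ne_zero h0
  have hKl0 : μ (K - l • K) ≠ 0 := by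
    obtain ⟨k, hk⟩ := hne
    refine fun h => h0 (measure_mono_null ?_ ((measure_preimage_add_right μ (-(l • k)) _).trans h))
    intro x hx
    exact ⟨x, hx, l • k, ⟨k, hk, rfl⟩, by simp [sub_eq_add_neg]⟩
  have hm : MeasurableSet {z | y - z ∈ (l - ε) • K} :=
    (hK.smul (l - ε)).measurableSet.preimage (measurable_const.sub measurable_id)
  have hsub : {z | y - z ∈ (l - ε) • K} ⊆ K - l • K := by
    obtain ⟨a, ha, b, hb, rfl⟩ := hy
    intro z hz
    refine ⟨a, ha, b + (a - b - z), ?_, by simp only; abel⟩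
    have := Set.add_mem_add (s := (l - ε) • K) hz hb
    rw [← hc.add_smul (sub_nonneg.2 hl) hε, sub_add_cancel] at this
    rwa [add_comm]
  have hvol : μ {z | y - z ∈ (l - ε) • K} = ENNReal.ofReal ((l - ε) ^ Module.finrank ℝ E) * μ K := by
    rw [← Measure.addHaar_smul_of_nonneg _ (sub_nonneg.2 hl)]
    exact (Measure.measurePreserving_sub_left μ y).measure_preimage
      (hK.smul (l - ε)).measurableSet.nullMeasurableSet
  have hprob : P.real {ω | y - X ω ∈ (l - ε) • K} =
      (l - ε) ^ Module.finrank ℝ E * (μ.real K / μ.real (K - l • K)) := by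
    have := hu.measure_preimage hKl0 hKl.measure_ne_top hm
    rw [Set.inter_eq_self_of_subset_right hsub, hvol] at this
    change (P (X ⁻¹' {z | y - z ∈ (l - ε) • K})).toReal = _
    rw [this, ENNReal.toReal_div, ENNReal.toReal_mul, ENNReal.toReal_ofReal
      (pow_nonneg (sub_nonneg.2 hl) _), mul_div_assoc]
    rfl
  have hm' : MeasurableSet {ω | y - X ω ∈ (l - ε) • K} := hX hm
  rw [← hprob, ← probReal_compl_eq_one_sub hm', ofReal_measureReal]
  rfl

theorem measure_not_subset_iUnion_mul_le {ι : Type*} [Fintype ι] {K : Set E} (hK : IsCompact K)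
    (hc : Convex ℝ K) (h0 : μ K ≠ 0) {l : ι → ℝ} {ε : ℝ} (hε : 0 ≤ ε) {I : Finset ι}
    (hl : ∀ i ∈ I, ε ≤ l i) {X : ι → Ω → E} (hX : ∀ i, Measurable (X i))
    (hu : ∀ i, pdf.IsUniform (X i) (K - l i • K) P μ) (hind : iIndepFun X P) :
    ENNReal.ofReal (ε ^ Module.finrank ℝ E) * μ K *
        P {ω | ¬ K ⊆ ⋃ i, X i ω +ᵥ l i • K} ≤
      μ (K - ε • K) * ∏ i ∈ I, ENNReal.ofReal
        (1 - (l i - ε) ^ Module.finrank ℝ E * (μ.real K / μ.real (K - l i • K))) := by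
  have hKε : MeasurableSet (K - ε • K) := (hK.sub (hK.smul ε)).measurableSet
  let S : Set (Ω × E) := ⋂ i ∈ I, {p | p.2 - X i p.1 ∉ (l i - ε) • K}
  have hS : MeasurableSet S := Finset.measurableSet_biInter _ fun i _ =>
    (((hK.smul (l i - ε)).measurableSet.preimage
      (measurable_snd.sub ((hX i).comp measurable_fst)))).compl
  have hbad : ∀ ω, ¬ K ⊆ ⋃ i, X i ω +ᵥ l i • K →
      ENNReal.ofReal (ε ^ Module.finrank ℝ E) * μ K ≤
        μ.restrict (K - ε • K) (Prod.mk ω ⁻¹' S) := by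
    intro ω hω
    obtain ⟨x, hx, hxn⟩ := Set.not_subset.1 hω
    rw [Measure.restrict_apply (hS.preimage measurable_prodMk_left),
      ← Measure.addHaar_smul_of_nonneg _ hε,
      ← (Measure.measurePreserving_sub_left μ x).measure_preimage
        (hK.smul ε).measurableSet.nullMeasurableSet]
    refine measure_mono fun y hy => ⟨?_, x, hx, x - y, hy, by simp⟩
    simp only [S, Set.preimage_iInter, Set.mem_iInter]
    intro i hi hmem
    refine hxn (Set.mem_iUnion.2 ⟨i, ?_⟩)
    rw [Set.mem_vadd_set_iff_neg_vadd_mem, vadd_eq_add, neg_add_eq_sub]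
    have := Set.add_mem_add (t := ε • K) hmem hy
    rw [← hc.add_smul (sub_nonneg.2 (hl i hi)) hε, sub_add_cancel] at this
    convert this using 1
    simp
  calc _ ≤ ENNReal.ofReal (ε ^ Module.finrank ℝ E) * μ K *
        P {ω | ENNReal.ofReal (ε ^ Module.finrank ℝ E) * μ K ≤
          μ.restrict (K - ε • K) (Prod.mk ω ⁻¹' S)} := by
        exact mul_le_mul' le_rfl (measure_mono hbad)
    _ ≤ ∫⁻ ω, μ.restrict (K - ε • K) (Prod.mk ω ⁻¹' S) ∂P :=
        mul_meas_ge_le_lintegral (measurable_measure_prodMk_left hS) _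
    _ = ∫⁻ y in K - ε • K, P ((fun ω => (ω, y)) ⁻¹' S) ∂μ := by
        rw [← Measure.prod_apply hS, Measure.prod_apply_symm hS]
    _ = ∫⁻ y in K - ε • K, ∏ i ∈ I, ENNReal.ofReal
        (1 - (l i - ε) ^ Module.finrank ℝ E * (μ.real K / μ.real (K - l i • K))) ∂μ := by
        refine setLIntegral_congr_fun hKε fun y hy => ?_
        have hpre : (fun ω => (ω, y)) ⁻¹' S =
            ⋂ i ∈ I, X i ⁻¹' {z | y - z ∉ (l i - ε) • K} := by
          simp only [S, Set.preimage_iInter]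
          rfl
        simp only [hpre]
        rw [hind.measure_inter_preimage_eq_mul I (sets := fun i => {z | y - z ∉ (l i - ε) • K})
          fun i _ => ((hK.smul (l i - ε)).measurableSet.preimage
            (measurable_const.sub measurable_id)).compl]
        exact Finset.prod_congr rfl fun i hi =>
          pdf.IsUniform.measure_sub_notMem hK hc h0 hε (hl i hi) (hX i) (hu i) hy
    _ = _ := by rw [setLIntegral_const, mul_comm]

theorem measureReal_not_subset_iUnion_le {ι : Type*} [Fintype ι] {K : Set E} (hK : IsCompact K)
    (hc : Convex ℝ K) (h0 : μ K ≠ 0) (hz : 0 ∈ K) {l : ι → ℝ} {ε : ℝ} (hε : 0 < ε) (hε1 : ε ≤ 1)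
    {I : Finset ι} (hl : ∀ i ∈ I, ε ≤ l i) {X : ι → Ω → E} (hX : ∀ i, Measurable (X i))
    (hu : ∀ i, pdf.IsUniform (X i) (K - l i • K) P μ) (hind : iIndepFun X P) :
    P.real {ω | ¬ K ⊆ ⋃ i, X i ω +ᵥ l i • K} ≤
      (4 / ε) ^ Module.finrank ℝ E * Real.exp (-∑ i ∈ I,
        (l i - ε) ^ Module.finrank ℝ E * (μ.real K / μ.real (K - l i • K))) := by
  have hKt : μ K ≠ ⊤ := hK.measure_ne_top
  have hsub : μ (K - ε • K) ≤ 4 ^ Module.finrank ℝ E * μ K := by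
    refine (measure_mono (Set.sub_subset_sub_left ?_)).trans (hc.measure_sub_self_le hK h0)
    rintro _ ⟨k, hk, rfl⟩
    exact hc.smul_mem_of_zero_mem hz hk ⟨hε.le, hε1⟩
  have key := (measure_not_subset_iUnion_mul_le hK hc h0 hε.le hl hX hu hind).trans
    (mul_le_mul_left hsub _)
  have hfin : 4 ^ Module.finrank ℝ E * μ K * ∏ i ∈ I, ENNReal.ofReal
      (1 - (l i - ε) ^ Module.finrank ℝ E * (μ.real K / μ.real (K - l i • K))) ≠ ⊤ :=
    ENNReal.mul_ne_top (ENNReal.mul_ne_top (by simp) hKt)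
      (ENNReal.prod_ne_top fun _ _ => ENNReal.ofReal_ne_top)
  have key2 := ENNReal.toReal_mono hfin key
  simp only [ENNReal.toReal_mul, ENNReal.toReal_prod, ENNReal.toReal_ofReal (pow_nonneg hε.le _),
    ENNReal.toReal_pow, ENNReal.toReal_ofNat] at key2
  change ε ^ Module.finrank ℝ E * μ.real K * P.real _ ≤ 4 ^ Module.finrank ℝ E * μ.real K * _
    at key2
  have hKpos : 0 < μ.real K := ENNReal.toReal_pos h0 hKt
  have hprod : ∏ i ∈ I, (ENNReal.ofReal
      (1 - (l i - ε) ^ Module.finrank ℝ E * (μ.real K / μ.real (K - l i • K)))).toReal ≤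
      Real.exp (-∑ i ∈ I,
        (l i - ε) ^ Module.finrank ℝ E * (μ.real K / μ.real (K - l i • K))) := by
    rw [← Finset.sum_neg_distrib, Real.exp_sum]
    refine Finset.prod_le_prod (fun _ _ => ENNReal.toReal_nonneg) fun i _ => ?_
    refine ENNReal.toReal_le_of_le_ofReal (Real.exp_pos _).le (ENNReal.ofReal_le_ofReal ?_)
    exact Real.one_sub_le_exp_neg _
  have key3 := key2.trans (mul_le_mul_of_nonneg_left hprod (by positivity))
  rw [div_pow, div_mul_eq_mul_div, le_div_iff₀ (by positivity)]
  refine le_of_mul_le_mul_right ?_ hKpos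
  linarith

end Haar

theorem Convex.two_pow_mul_volume_sub_smul_le {n : ℕ} {K : Set (EuclideanSpace ℝ (Fin n))}
    (hK : IsCompact K) (hc : Convex ℝ K) {l : ℝ} (hl : 0 ≤ l) :
    2 ^ n * volume.real (K - l • K) ≤ (1 + l) ^ n * volume.real (K - K) := by
  have hA : IsCompact (K - l • K) := hK.sub (hK.smul l)
  have hD : IsCompact (K - K) := hK.sub hK
  have hsub : (K - l • K) + -(K - l • K) ⊆ (1 + l) • (K - K) := by
    rintro _ ⟨_, ⟨a, ha, _, ⟨b, hb, rfl⟩, rfl⟩, z, hz, rfl⟩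
    rw [Set.mem_neg] at hz
    obtain ⟨c, hc', _, ⟨d, hd, rfl⟩, hz⟩ := hz
    have h1 : a + l • d ∈ (1 + l) • K := by
      rw [hc.add_smul zero_le_one hl, one_smul]
      exact Set.add_mem_add ha ⟨d, hd, rfl⟩
    have h2 : c + l • b ∈ (1 + l) • K := by
      rw [hc.add_smul zero_le_one hl, one_smul]
      exact Set.add_mem_add hc' ⟨b, hb, rfl⟩
    obtain ⟨u, hu, hu'⟩ := h1
    obtain ⟨v, hv, hv'⟩ := h2
    refine ⟨u - v, Set.sub_mem_sub hu hv, ?_⟩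
    simp only at hu' hv' hz ⊢
    rw [smul_sub, hu', hv', ← neg_neg z, ← hz]
    abel
  have h1 := four_pow_mul_volume_mul_volume_le hA.measurableSet hA.neg.measurableSet
    (hD.smul (1 + l)).measurableSet hsub
  rw [Measure.measure_neg, Measure.addHaar_smul_of_nonneg _ (by positivity : 0 ≤ 1 + l),
    finrank_euclideanSpace_fin] at h1
  have h2 := ENNReal.toReal_mono (ENNReal.pow_ne_top (ENNReal.mul_ne_top ENNReal.ofReal_ne_top
    hD.measure_ne_top)) h1
  simp only [ENNReal.toReal_mul, ENNReal.toReal_pow, ENNReal.toReal_ofNat,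
    ENNReal.toReal_ofReal (pow_nonneg (by positivity : 0 ≤ 1 + l) n)] at h2
  have h4 : (4 : ℝ) ^ n = (2 ^ n) ^ 2 := by rw [← pow_mul, mul_comm, pow_mul]; norm_num
  rw [h4, ← sq, ← mul_pow] at h2
  exact (pow_le_pow_iff_left₀ (by positivity) (by positivity) two_ne_zero).1 h2

theorem one_sub_mul_pow_le_sub_pow {l ε δ : ℝ} (n : ℕ) (hl : 0 ≤ l) (hδ : δ ≤ 1)
    (h : ε ≤ δ * l) : (1 - n * δ) * l ^ n ≤ (l - ε) ^ n := by
  have h1 : 1 - n * δ ≤ (1 - δ) ^ n := by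
    have := one_add_mul_le_pow (a := -δ) (by linarith) n
    simpa [sub_eq_add_neg] using this
  calc (1 - n * δ) * l ^ n ≤ (1 - δ) ^ n * l ^ n := by gcongr
    _ = ((1 - δ) * l) ^ n := (mul_pow _ _ _).symm
    _ ≤ (l - ε) ^ n := pow_le_pow_left₀ (mul_nonneg (by linarith) hl) (by linarith) n

theorem measureReal_not_subset_iUnion_le_exp {n : ℕ} {K : Set (EuclideanSpace ℝ (Fin n))}
    (hK : IsCompact K) (hc : Convex ℝ K) (h0 : volume K ≠ 0) (hz : 0 ∈ K) {ι : Type*} [Fintype ι]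
    {l : ι → ℝ} (hlpos : ∀ i, 0 ≤ l i) {ε δ q : ℝ} (hε : 0 < ε) (hε1 : ε ≤ 1) (hδ1 : δ ≤ 1)
    {I : Finset ι} (hlI : ∀ i ∈ I, ε ≤ δ * l i)
    (hq : ∀ i ∈ I, q * volume.real (K - l i • K) ≤ volume.real (K - K))
    {Ω : Type*} [MeasurableSpace Ω] {P : Measure Ω} [IsProbabilityMeasure P]
    {X : ι → Ω → EuclideanSpace ℝ (Fin n)} (hX : ∀ i, Measurable (X i))
    (hu : ∀ i, pdf.IsUniform (X i) (K - l i • K) P volume) (hind : iIndepFun X P)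
    (hqn : 0 ≤ q) :
    P.real {ω | ¬ K ⊆ ⋃ i, X i ω +ᵥ l i • K} ≤ (4 / ε) ^ n *
      Real.exp (-((1 - n * δ) * (q * ∑ i ∈ I, l i ^ n / (volume.real (K - K) / volume.real K)))) := by
  have hle : ∀ i ∈ I, ε ≤ l i := fun i hi =>
    (hlI i hi).trans (mul_le_of_le_one_left (hlpos i) hδ1)
  have hV : 0 < volume.real K := ENNReal.toReal_pos h0 hK.measure_ne_top
  have hmono : ∀ s : ℝ, volume.real K ≤ volume.real (K - s • K) := by
    intro s
    refine ENNReal.toReal_mono (hK.sub (hK.smul s)).measure_ne_top (measure_mono fun x hx => ?_)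
    exact ⟨x, hx, 0, ⟨0, hz, smul_zero s⟩, sub_zero x⟩
  have hW : 0 < volume.real (K - K) := hV.trans_le (by simpa using hmono 1)
  have key := measureReal_not_subset_iUnion_le hK hc h0 hz hε hε1 hle hX hu hind
  rw [finrank_euclideanSpace_fin] at key
  refine key.trans (mul_le_mul_of_nonneg_left (Real.exp_le_exp.2 (neg_le_neg ?_)) (by positivity))
  rw [Finset.mul_sum, Finset.mul_sum]
  refine Finset.sum_le_sum fun i hi => ?_
  have hpow := one_sub_mul_pow_le_sub_pow n (hlpos i) hδ1 (hlI i hi)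
  have hpos := hV.trans_le (hmono (l i))
  have hratio : q * (volume.real K / volume.real (K - K)) ≤
      volume.real K / volume.real (K - l i • K) := by
    rw [mul_div_assoc', div_le_div_iff₀ hW hpos]
    nlinarith [hq i hi]
  calc (1 - n * δ) * (q * (l i ^ n / (volume.real (K - K) / volume.real K)))
      = (1 - n * δ) * l i ^ n * (q * (volume.real K / volume.real (K - K))) := by
        field_simp
    _ ≤ (l i - ε) ^ n * (q * (volume.real K / volume.real (K - K))) := by
        gcongr
    _ ≤ _ := by
        gcongr
        exact pow_nonneg (sub_nonneg.2 (hle i hi)) _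

theorem eventually_two_mul_log_add_le :
    ∀ᶠ u : ℝ in Filter.atTop, 0 < u ∧ 2 * (Real.log u + 3.9) ≤ 0.2 * u := by
  filter_upwards [Real.isLittleO_log_id_atTop.bound (by norm_num : (0 : ℝ) < 0.05),
    Filter.eventually_ge_atTop (100 : ℝ)] with u hu hu1
  have h1 := (le_abs_self _).trans hu
  rw [id, Real.norm_of_nonneg (by linarith)] at h1
  constructor <;> linarith

theorem eventually_mul_le_four_thirds_pow :
    ∀ᶠ n : ℕ in Filter.atTop, 200 * (n : ℝ) ≤ (4 / 3) ^ n := by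
  have h := tendsto_pow_const_mul_const_pow_of_abs_lt_one 1
    (r := 3 / 4) (by rw [abs_of_pos] <;> norm_num)
  filter_upwards [h.eventually_le_const (by norm_num : (0 : ℝ) < 1 / 200)] with n hn
  have h1 : (3 / 4 : ℝ) ^ n * (4 / 3) ^ n = 1 := by rw [← mul_pow]; norm_num
  have h2 : (0 : ℝ) < (4 / 3) ^ n := by positivity
  rw [pow_one] at hn
  nlinarith [mul_le_mul_of_nonneg_right hn h2.le]

theorem pow_mul_exp_neg_le {a b c : ℝ} {n : ℕ} (ha : 0 < a) (h : n * Real.log a + c ≤ b) :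
    a ^ n * Real.exp (-b) ≤ Real.exp (-c) := by
  rw [← Real.exp_log (pow_pos ha n), ← Real.exp_add, Real.log_pow]
  exact Real.exp_le_exp.2 (by linarith)

theorem log_four_lt : Real.log 4 < 1.387 := by
  have : Real.log 4 = 2 * Real.log 2 := by
    rw [show (4 : ℝ) = 2 ^ 2 by norm_num, Real.log_pow]; norm_num
  linarith [Real.log_two_lt_d9]

theorem measureReal_not_subset_iUnion_le_of_small {n : ℕ} (hn : 1 ≤ n)
    (hn2 : 200 * (n : ℝ) ≤ (4 / 3) ^ n)
    {K : Set (EuclideanSpace ℝ (Fin n))}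
    (hK : IsCompact K) (hc : Convex ℝ K) (h0 : volume K ≠ 0) (hz : 0 ∈ K) {ι : Type*} [Fintype ι]
    {l : ι → ℝ} (hl : ∀ i, Real.exp (-(n : ℝ)) < l i)
    {I : Finset ι} (hI : ∀ i ∈ I, l i < 1 / 2)
    (hsum : n / 10 ≤ ∑ i ∈ I, l i ^ n / (volume.real (K - K) / volume.real K))
    {Ω : Type*} [MeasurableSpace Ω] {P : Measure Ω} [IsProbabilityMeasure P]
    {X : ι → Ω → EuclideanSpace ℝ (Fin n)} (hX : ∀ i, Measurable (X i))
    (hu : ∀ i, pdf.IsUniform (X i) (K - l i • K) P volume) (hind : iIndepFun X P) :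
    P.real {ω | ¬ K ⊆ ⋃ i, X i ω +ᵥ l i • K} ≤ Real.exp (-(0.3 * n)) := by
  have hn' : (1 : ℝ) ≤ n := by exact_mod_cast hn
  have hlpos : ∀ i, 0 ≤ l i := fun i => (Real.exp_pos _).le.trans (hl i).le
  have hexp1 : Real.exp (-(n : ℝ)) ≤ 1 := Real.exp_le_one_iff.2 (by linarith)
  have hδ1 : 1 / (2 * n : ℝ) ≤ 1 := by
    rw [div_le_one (by positivity)]
    linarith
  have hq : ∀ i ∈ I, (4 / 3 : ℝ) ^ n * volume.real (K - l i • K) ≤ volume.real (K - K) := by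
    intro i hi
    have h1 := hc.two_pow_mul_volume_sub_smul_le hK (hlpos i)
    have h2 : (1 + l i) ^ n ≤ (3 / 2 : ℝ) ^ n :=
      pow_le_pow_left₀ (by linarith [hlpos i]) (by linarith [hI i hi]) n
    have h3 : (2 : ℝ) ^ n = (3 / 2) ^ n * (4 / 3) ^ n := by rw [← mul_pow]; norm_num
    have h4 := h1.trans (mul_le_mul_of_nonneg_right h2 measureReal_nonneg)
    rw [h3, mul_assoc] at h4
    exact le_of_mul_le_mul_left h4 (by positivity)
  have key := measureReal_not_subset_iUnion_le_exp hK hc h0 hz hlpos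
    (ε := 1 / (2 * n) * Real.exp (-(n : ℝ))) (by positivity)
    (mul_le_one₀ hδ1 (Real.exp_pos _).le hexp1) hδ1 (I := I)
    (fun i _ => mul_le_mul_of_nonneg_left (hl i).le (by positivity)) hq hX hu hind (by positivity)
  refine key.trans (pow_mul_exp_neg_le (by positivity) ?_)
  have hhalf : 1 - (n : ℝ) * (1 / (2 * n)) = 1 / 2 := by field_simp; norm_num
  have hlog : Real.log (4 / (1 / (2 * n) * Real.exp (-(n : ℝ)))) ≤ 9 * n := by
    have h1 : 4 / (1 / (2 * n) * Real.exp (-(n : ℝ))) = (8 * n) * Real.exp n := by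
      rw [Real.exp_neg]
      field_simp
      norm_num
    rw [h1, Real.log_mul (by positivity) (by positivity), Real.log_exp]
    linarith [Real.log_le_self (by positivity : (0 : ℝ) ≤ 8 * n)]
  rw [hhalf]
  calc n * Real.log (4 / (1 / (2 * n) * Real.exp (-(n : ℝ)))) + 0.3 * n
      ≤ n * (9 * n) + 0.3 * n := by gcongr
    _ ≤ 1 / 2 * ((200 * n) * (n / 10)) := by nlinarith
    _ ≤ _ := by gcongr

theorem measureReal_not_subset_iUnion_le_of_large {n : ℕ} (hn : 2 ≤ n)
    (hn2 : 0 < Real.log n ∧ 2 * (Real.log (Real.log n) + 3.9) ≤ 0.2 * Real.log n)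
    {K : Set (EuclideanSpace ℝ (Fin n))}
    (hK : IsCompact K) (hc : Convex ℝ K) (h0 : volume K ≠ 0) (hz : 0 ∈ K) {ι : Type*} [Fintype ι]
    {l : ι → ℝ} (hl : ∀ i, l i ∈ Set.Ioo 0 1)
    {I : Finset ι} (hI : ∀ i ∈ I, 1 / 2 ≤ l i)
    (hsum : (n : ℝ) * Real.log n + n * Real.log (Real.log n) + 3.9 * n ≤
      ∑ i ∈ I, l i ^ n / (volume.real (K - K) / volume.real K))
    (hlog2 : 4 ≤ Real.log n)
    {Ω : Type*} [MeasurableSpace Ω] {P : Measure Ω} [IsProbabilityMeasure P]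
    {X : ι → Ω → EuclideanSpace ℝ (Fin n)} (hX : ∀ i, Measurable (X i))
    (hu : ∀ i, pdf.IsUniform (X i) (K - l i • K) P volume) (hind : iIndepFun X P) :
    P.real {ω | ¬ K ⊆ ⋃ i, X i ω +ᵥ l i • K} ≤ Real.exp (-(0.3 * n)) := by
  obtain ⟨hu0, hu1⟩ := hn2
  have hn' : (2 : ℝ) ≤ n := by exact_mod_cast hn
  have hlpos : ∀ i, 0 ≤ l i := fun i => (hl i).1.le
  set u := Real.log n with hu_def
  have hnu : 8 ≤ n * u := by nlinarith
  have hδ1 : 2 * (1 / (n * u)) ≤ 1 := by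
    rw [mul_one_div, div_le_one (by positivity)]
    linarith
  have hq : ∀ i ∈ I, (1 : ℝ) * volume.real (K - l i • K) ≤ volume.real (K - K) := by
    intro i hi
    rw [one_mul]
    refine ENNReal.toReal_mono (hK.sub hK).measure_ne_top
      (measure_mono (Set.sub_subset_sub_left ?_))
    rintro _ ⟨k, hk, rfl⟩
    exact hc.smul_mem_of_zero_mem hz hk ⟨hlpos i, (hl i).2.le⟩
  have hpos : 0 < 1 / (n * u) := by positivity
  have key := measureReal_not_subset_iUnion_le_exp hK hc h0 hz hlpos
    (ε := 1 / (n * u)) hpos (by linarith) hδ1 (I := I)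
    (fun i hi => by nlinarith [hI i hi]) hq hX hu hind zero_le_one
  refine key.trans (pow_mul_exp_neg_le (by positivity) ?_)
  have hδ : 1 - (n : ℝ) * (2 * (1 / (n * u))) = 1 - 2 / u := by field_simp
  have hlog : Real.log (4 / (1 / (n * u))) = Real.log 4 + u + Real.log u := by
    rw [div_div_eq_mul_div, div_one, Real.log_mul (by norm_num) (by positivity),
      Real.log_mul (by positivity) hu0.ne', ← hu_def, add_assoc]
  rw [hδ, hlog, one_mul]
  have h2u : 2 / u ≤ 1 := by
    rw [div_le_one hu0]
    linarith
  refine le_trans ?_ (mul_le_mul_of_nonneg_left hsum (sub_nonneg.2 h2u))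
  have h3 : 2 / u * (Real.log u + 3.9) ≤ 0.2 := by
    rw [div_mul_eq_mul_div, div_le_iff₀ hu0]
    exact hu1
  have h4 : 2 / u * u = 2 := div_mul_cancel₀ _ hu0.ne'
  have h5 : Real.log 4 + u + Real.log u + 0.3 ≤ (1 - 2 / u) * (u + Real.log u + 3.9) := by
    have : (1 - 2 / u) * (u + Real.log u + 3.9) =
      u + Real.log u + 3.9 - 2 / u * u - 2 / u * (Real.log u + 3.9) := by ring
    rw [this, h4]
    linarith [log_four_lt]
  nlinarith [mul_le_mul_of_nonneg_left h5 (by linarith : (0 : ℝ) ≤ n)]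

theorem proposition1 :
    ∃ N : ℕ, ∀ n : ℕ, N ≤ n →
      ∀ K : ConvexBody (EuclideanSpace ℝ (Fin n)),
        (0 : EuclideanSpace ℝ (Fin n)) ∈ interior (K : Set (EuclideanSpace ℝ (Fin n))) →
      ∀ (m : ℕ) (lam : Fin m → ℝ),
        (∀ i, lam i ∈ Set.Ioo (Real.exp (-(n : ℝ))) 1) →
        ((n : ℝ) * Real.log n + n * Real.log (Real.log n) + 4 * n) *
            (volume.real ((K : Set (EuclideanSpace ℝ (Fin n))) -
                (K : Set (EuclideanSpace ℝ (Fin n)))) /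
              volume.real (K : Set (EuclideanSpace ℝ (Fin n))))
          ≤ ∑ i, lam i ^ n →
      ∀ (Ω : Type*) [MeasurableSpace Ω] (P : Measure Ω) [IsProbabilityMeasure P]
        (X : Fin m → Ω → EuclideanSpace ℝ (Fin n)),
        (∀ i, Measurable (X i)) →
        (∀ i, pdf.IsUniform (X i)
          ((K : Set (EuclideanSpace ℝ (Fin n))) -
            lam i • (K : Set (EuclideanSpace ℝ (Fin n)))) P volume) →
        iIndepFun X P →
        MeasurableSet {ω | (K : Set (EuclideanSpace ℝ (Fin n))) ⊆
            ⋃ i, X i ω +ᵥ lam i • (K : Set (EuclideanSpace ℝ (Fin n)))} ∧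
          1 - Real.exp (-(0.3 : ℝ) * n) ≤
            P.real {ω | (K : Set (EuclideanSpace ℝ (Fin n))) ⊆
              ⋃ i, X i ω +ᵥ lam i • (K : Set (EuclideanSpace ℝ (Fin n)))} := by
  have hlog : Filter.Tendsto (fun n : ℕ => Real.log n) Filter.atTop Filter.atTop :=
    Real.tendsto_log_atTop.comp tendsto_natCast_atTop_atTop
  obtain ⟨N, hN⟩ := Filter.eventually_atTop.1 (((hlog.eventually eventually_two_mul_log_add_le).and
    (hlog.eventually_ge_atTop 4)).and
    (eventually_mul_le_four_thirds_pow.and (Filter.eventually_ge_atTop 2)))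
  refine ⟨N, fun n hn K h0 m lam hlam hsum Ω _ P _ X hX hu hind => ?_⟩
  obtain ⟨⟨hn1, hn4⟩, hn2, hn3⟩ := hN n hn
  have hK : IsCompact (K : Set (EuclideanSpace ℝ (Fin n))) := K.isCompact
  have hmeas : MeasurableSet {ω | ¬ (K : Set (EuclideanSpace ℝ (Fin n))) ⊆
      ⋃ i, X i ω +ᵥ lam i • (K : Set (EuclideanSpace ℝ (Fin n)))} :=
    (isOpen_setOf_not_subset_iUnion_vadd (K := (K : Set (EuclideanSpace ℝ (Fin n))))
      fun i => (hK.smul (lam i)).isClosed).measurableSet.preimage (measurable_pi_iff.2 hX)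
  have hmeas' : MeasurableSet {ω | (K : Set (EuclideanSpace ℝ (Fin n))) ⊆
      ⋃ i, X i ω +ᵥ lam i • (K : Set (EuclideanSpace ℝ (Fin n)))} :=
    MeasurableSet.of_compl hmeas
  refine ⟨hmeas', ?_⟩
  have hcompl := probReal_compl_eq_one_sub (μ := P) hmeas'
  have hpos : volume (K : Set (EuclideanSpace ℝ (Fin n))) ≠ 0 :=
    (Measure.measure_pos_of_nonempty_interior _ ⟨0, h0⟩).ne'
  have hz := interior_subset h0
  have hV : 0 < volume.real (K : Set (EuclideanSpace ℝ (Fin n))) :=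
    ENNReal.toReal_pos hpos hK.measure_ne_top
  have hW : 0 < volume.real ((K : Set (EuclideanSpace ℝ (Fin n))) -
      (K : Set (EuclideanSpace ℝ (Fin n)))) :=
    hV.trans_le (ENNReal.toReal_mono (hK.sub hK).measure_ne_top
      (measure_mono fun x hx => ⟨x, hx, 0, hz, sub_zero x⟩))
  have hsum' := (le_div_iff₀ (div_pos hW hV)).2 hsum
  rw [Finset.sum_div, ← Finset.sum_filter_add_sum_filter_not _ (fun i => lam i < 1 / 2)] at hsum'
  have hbad : P.real {ω | ¬ (K : Set (EuclideanSpace ℝ (Fin n))) ⊆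
      ⋃ i, X i ω +ᵥ lam i • (K : Set (EuclideanSpace ℝ (Fin n)))} ≤ Real.exp (-(0.3 * n)) := by
    by_cases hcase : (n : ℝ) / 10 ≤ ∑ i with lam i < 1 / 2, lam i ^ n /
        (volume.real ((K : Set (EuclideanSpace ℝ (Fin n))) -
      (K : Set (EuclideanSpace ℝ (Fin n)))) /
          volume.real (K : Set (EuclideanSpace ℝ (Fin n))))
    · exact measureReal_not_subset_iUnion_le_of_small (by omega) hn2 hK K.convex hpos hz
        (fun i => (hlam i).1) (fun i hi => (Finset.mem_filter.1 hi).2) hcase hX hu hind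
    · exact measureReal_not_subset_iUnion_le_of_large hn3 hn1 hK K.convex hpos hz
        (I := Finset.univ.filter fun i => ¬ lam i < 1 / 2)
        (fun i => ⟨(Real.exp_pos _).trans (hlam i).1, (hlam i).2⟩)
        (fun i hi => not_lt.1 (Finset.mem_filter.1 hi).2) (by linarith) hn4 hX hu hind
  change P.real {ω | ¬ (K : Set (EuclideanSpace ℝ (Fin n))) ⊆
      ⋃ i, X i ω +ᵥ lam i • (K : Set (EuclideanSpace ℝ (Fin n)))} = _ at hcompl
  rw [neg_mul]
  linarith
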